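/- Consider $n\ge 2$ deterministic processes with unique identifiers, each with an input value from a fixed set of $m\ge 2$ possible values, in an asynchronous system: there are no bounds on the relative speeds of the processes or on message delays. The processes communicate either by atomically reading and writing shared registers (multi-writer multi-reader, or single-writer multi-reader) or by sending and receiving messages over a reliable network. A process may crash, i.e. halt prematurely; apart from that it follows its code. A $t$-resilient $(n,k)$-partial agreement algorithm is one such that, for all input vectors, (a) in every execution there is a value $v$ that is the input of at least one process (weak validity) and such that at most $n-k$ processes decide on values other than $v$ (agreement), and (b) in every execution in which at most $t$ processes crash, each process that does not crash eventually decides and terminates. Under strong validity one requires in addition that every decided value is the input of some process. Then for all integers $n\ge 2$, $m\ge 2$, $k\ge 0$, in each of these communication models and under weak as well as under strong validity, there exists an $(n,k)$-partial agreement algorithm that tolerates a single crash failure ($t=1$) if and only if $k\le\lceil n/2\rceil$. -/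

import Mathlib

namespace PartialAgreement

/-! ### The problem -/

/-- The two validity requirements. -/
inductive Validity where
  | weak
  | strong

/-- The local condition of one of the `n` deterministic machines: it is either still executing its
code, in local state `s`, or it has decided on a value and terminated.
Input values are the elements of `Fin m`; a decided value may be any natural number. -/
inductive Status (S : Type) where
  | running (s : S)
  | decided (v : ℕ)

/-- `p` takes infinitely many steps in the schedule `σ`, i.e. `p` does not crash.  (Steps of a
machine that has terminated have no effect.) -/
def Correct {n : ℕ} (σ : ℕ → Fin n) (p : Fin n) : Prop :=
  ∀ N, ∃ i, N ≤ i ∧ σ i = p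

/-- At most `t` of the `n` machines crash in the schedule `σ`. -/
def AtMostCrashes {n : ℕ} (t : ℕ) (σ : ℕ → Fin n) : Prop :=
  {p : Fin n | ¬ Correct σ p}.ncard ≤ t

/-- Agreement together with validity for one execution with input vector `x`, where
`Decides p w` says that `p` decides on `w` in the execution: there is a proposed value `v` such that
at most `n - k` machines decide on values other than `v` (written without subtraction);
under strong validity, moreover, every decided value is a proposed value. -/
def Safe {n m : ℕ} (val : Validity) (k : ℕ) (x : Fin n → Fin m)
    (Decides : Fin n → ℕ → Prop) : Prop :=
  (∃ v : ℕ, (∃ i, (x i : ℕ) = v) ∧ {p : Fin n | ∃ w, Decides p w ∧ w ≠ v}.ncard + k ≤ n) ∧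
  (val = Validity.strong → ∀ p w, Decides p w → ∃ i, (x i : ℕ) = w)

/-! ### Asynchronous shared memory with atomic read/write registers -/

/-- The next atomic operation of a machine: read a register and continue in a state that depends on
the value read, write a value into a register, or decide and terminate. -/
inductive RWAction (S R V : Type) where
  | read (r : R) (next : V → S)
  | write (r : R) (v : V) (next : S)
  | decide (v : ℕ)

/-- An algorithm for `n` machines with `m` possible input values that communicate through atomic
registers; each register can be read and written by everyone. The code may depend on the
identifier `p : Fin n`. -/
structure RWAlgorithm (n m : ℕ) where
  State : Type
  Reg : Type
  Val : Type
  start : Fin n → Fin m → State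
  startVal : Reg → Val
  act : Fin n → State → RWAction State Reg Val

namespace RWAlgorithm

variable {n m : ℕ}

structure Config (A : RWAlgorithm n m) where
  loc : Fin n → Status A.State
  mem : A.Reg → A.Val

def initial (A : RWAlgorithm n m) (x : Fin n → Fin m) : A.Config where
  loc p := Status.running (A.start p (x p))
  mem := A.startVal

open Classical in
/-- One atomic step of `p`. -/
noncomputable def step (A : RWAlgorithm n m) (p : Fin n) (c : A.Config) : A.Config :=
  match c.loc p with
  | Status.decided _ => c
  | Status.running s =>
    match A.act p s with
    | RWAction.read r next =>
        ⟨Function.update c.loc p (Status.running (next (c.mem r))), c.mem⟩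
    | RWAction.write r v next =>
        ⟨Function.update c.loc p (Status.running next), Function.update c.mem r v⟩
    | RWAction.decide v => ⟨Function.update c.loc p (Status.decided v), c.mem⟩

/-- The configuration after the first `i` steps of the execution with input vector `x` in which the
machines take steps in the order `σ 0, σ 1, …`. -/
noncomputable def run (A : RWAlgorithm n m) (x : Fin n → Fin m) (σ : ℕ → Fin n) : ℕ → A.Config
  | 0 => A.initial x
  | i + 1 => A.step (σ i) (A.run x σ i)

def Decides (A : RWAlgorithm n m) (x : Fin n → Fin m) (σ : ℕ → Fin n) (p : Fin n) (v : ℕ) : Prop :=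
  ∃ i, (A.run x σ i).loc p = Status.decided v

/-- `A` is a `t`-resilient `(n,k)`-partial agreement algorithm: agreement and validity hold in every
execution, and, if at most `t` machines crash, every machine that does not crash decides. -/
def Solves (A : RWAlgorithm n m) (val : Validity) (k t : ℕ) : Prop :=
  ∀ (x : Fin n → Fin m) (σ : ℕ → Fin n),
    Safe val k x (A.Decides x σ) ∧
    (AtMostCrashes t σ → ∀ p, Correct σ p → ∃ v, A.Decides x σ p v)

/-- Each register is written by a single predefined machine only. -/
def SingleWriter (A : RWAlgorithm n m) : Prop :=
  ∃ owner : A.Reg → Fin n, ∀ p s r v next, A.act p s = RWAction.write r v next → owner r = p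

end RWAlgorithm

/-! ### Asynchronous message passing -/

/-- The next atomic operation of a machine: send a message to `dst`; attempt to receive a message,
continuing in a state that depends on the result (`none` if nothing is received, otherwise the
sender and the content); or decide and terminate. -/
inductive MPAction (n : ℕ) (S M : Type) where
  | send (dst : Fin n) (msg : M) (next : S)
  | receive (next : Option (Fin n × M) → S)
  | decide (v : ℕ)

/-- A message in transit. -/
structure Envelope (n : ℕ) (M : Type) where
  src : Fin n
  dst : Fin n
  msg : M

/-- An algorithm for `n` machines with `m` possible input values that communicate by sending and
receiving messages. -/
structure MPAlgorithm (n m : ℕ) where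
  State : Type
  Msg : Type
  start : Fin n → Fin m → State
  act : Fin n → State → MPAction n State Msg

namespace MPAlgorithm

variable {n m : ℕ}

/-- `net j` is the message that was sent in step number `j` of the execution, as long as it is in
transit; it is `none` if no message was sent in step `j` or the message has been received. -/
structure Config (A : MPAlgorithm n m) where
  loc : Fin n → Status A.State
  net : ℕ → Option (Envelope n A.Msg)

def initial (A : MPAlgorithm n m) (x : Fin n → Fin m) : A.Config where
  loc p := Status.running (A.start p (x p))
  net _ := none

/-- The step number `i` of an execution, taken by `p`. If it is an attempt to receive, then
`choice = some j` means that the network hands over the message sent in step `j`, if this is a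
message in transit to `p`; in all other cases nothing is received. -/
def step (A : MPAlgorithm n m) (i : ℕ) (p : Fin n) (choice : Option ℕ) (c : A.Config) :
    A.Config :=
  match c.loc p with
  | Status.decided _ => c
  | Status.running s =>
    match A.act p s with
    | MPAction.send q msg next =>
        ⟨Function.update c.loc p (Status.running next),
          Function.update c.net i (some ⟨p, q, msg⟩)⟩
    | MPAction.receive next =>
        let nothing : A.Config :=
          ⟨Function.update c.loc p (Status.running (next none)), c.net⟩
        match choice with
        | none => nothing
        | some j =>
          match c.net j with
          | none => nothing
          | some e =>
            if e.dst = p then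
              ⟨Function.update c.loc p (Status.running (next (some (e.src, e.msg)))),
                Function.update c.net j none⟩
            else nothing
    | MPAction.decide v => ⟨Function.update c.loc p (Status.decided v), c.net⟩

/-- The configuration after the first `i` steps of the execution with input vector `x`, schedule `σ`
and network behaviour `ρ`. -/
def run (A : MPAlgorithm n m) (x : Fin n → Fin m) (σ : ℕ → Fin n) (ρ : ℕ → Option ℕ) :
    ℕ → A.Config
  | 0 => A.initial x
  | i + 1 => A.step i (σ i) (ρ i) (A.run x σ ρ i)

def Decides (A : MPAlgorithm n m) (x : Fin n → Fin m) (σ : ℕ → Fin n) (ρ : ℕ → Option ℕ)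
    (p : Fin n) (v : ℕ) : Prop :=
  ∃ i, (A.run x σ ρ i).loc p = Status.decided v

/-- Step number `i` is an attempt of `p` to receive a message. -/
def ReceivesAt (A : MPAlgorithm n m) (x : Fin n → Fin m) (σ : ℕ → Fin n) (ρ : ℕ → Option ℕ)
    (p : Fin n) (i : ℕ) : Prop :=
  σ i = p ∧ ∃ s next, (A.run x σ ρ i).loc p = Status.running s ∧
    A.act p s = MPAction.receive next

/-- The network is reliable: a machine that attempts to receive infinitely often eventually receives
every message sent to it. There is no bound on the delay and no order of delivery. -/
def Reliable (A : MPAlgorithm n m) (x : Fin n → Fin m) (σ : ℕ → Fin n) (ρ : ℕ → Option ℕ) : Prop :=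
  ∀ p, (∀ N, ∃ i, N ≤ i ∧ A.ReceivesAt x σ ρ p i) →
    ∀ i j e, (A.run x σ ρ i).net j = some e → e.dst = p →
      ∃ i', i ≤ i' ∧ (A.run x σ ρ i').net j = none

/-- `A` is a `t`-resilient `(n,k)`-partial agreement algorithm. (Agreement and validity only concern
finite parts of executions, and each of these can be continued with a reliable network; so
reliability matters only for termination.) -/
def Solves (A : MPAlgorithm n m) (val : Validity) (k t : ℕ) : Prop :=
  ∀ (x : Fin n → Fin m) (σ : ℕ → Fin n) (ρ : ℕ → Option ℕ),
    Safe val k x (A.Decides x σ ρ) ∧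
    (AtMostCrashes t σ → A.Reliable x σ ρ → ∀ p, Correct σ p → ∃ v, A.Decides x σ ρ p v)

end MPAlgorithm

/-! ### Solvability -/

/-- Solvable with multi-writer multi-reader registers. -/
def SolvableMWMR (val : Validity) (n m k t : ℕ) : Prop :=
  ∃ A : RWAlgorithm n m, A.Solves val k t

/-- Solvable with single-writer multi-reader registers. -/
def SolvableSWMR (val : Validity) (n m k t : ℕ) : Prop :=
  ∃ A : RWAlgorithm n m, A.SingleWriter ∧ A.Solves val k t

/-- Solvable by message passing. -/
def SolvableMP (val : Validity) (n m k t : ℕ) : Prop :=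
  ∃ A : MPAlgorithm n m, A.Solves val k t

end PartialAgreement

/-!
Both directions are linked by one chain of implications: `k ≤ ⌈n / 2⌉` gives a message passing
algorithm, message passing can be simulated with single-writer registers, single-writer registers
are a special case of multi-writer registers, and with the latter `k > ⌈n / 2⌉` is impossible.

*Algorithm* (`MPAlgorithm.solves_twoLeaders`). Two leaders send their inputs to everybody and decide
on them; everyone else waits for one message and decides on its content. One crash cannot silence
both leaders. At most two values are decided, both are inputs, and the less popular of them is
decided by at most `⌊n / 2⌋ = n - ⌈n / 2⌉` machines.

*Simulation* (`SolvableMP.solvableSWMR`). The `a`-th message of machine `p` is written into a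
register `(p, a)`, and an attempt to receive reads one register, chosen by an enumeration in which
each register occurs infinitely often. Every step of the simulation is one step of an execution of
the message passing algorithm (`MPAlgorithm.represents_run`), under the same schedule and with a
reliable network (`MPAlgorithm.reliable_simNetwork`).

*Impossibility* (`RWAlgorithm.Solves.two_mul_lt`). If `k > ⌈n / 2⌉`, then a value decided by
`k - 1` machines can only be the value `v` of the agreement condition, and in an execution with at
most one crash `k - 1` machines do decide on `v`. Partial agreement therefore has the properties of
consensus that a valence argument uses. There is a bivalent initial configuration, and since two
steps of different machines either commute or one of them is hidden from all other machines
(`RWAlgorithm.step_step_cases`), bivalence can be preserved while an arbitrary machine is made to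
take a step (`RWAlgorithm.Solves.exists_bivalent_extension`). This yields an execution without
crashes in which no value is ever settled.
-/

namespace PartialAgreement

/-! ### Schedules -/

/-- Every countable nonempty type has an enumeration in which each element occurs infinitely
often. -/
theorem exists_fair_enumeration (α : Type) [Nonempty α] [Countable α] :
    ∃ f : ℕ → α, ∀ a N, ∃ i, N ≤ i ∧ f i = a := by
  obtain ⟨g, hg⟩ := exists_surjective_nat α
  refine ⟨fun i => g i.unpair.2, fun a N => ?_⟩
  obtain ⟨b, rfl⟩ := hg a
  exact ⟨Nat.pair N b, Nat.left_le_pair N b, by simp⟩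

/-- The infinite schedule that starts with the finite schedule `l` and continues with `τ`. -/
def follow {n : ℕ} (l : List (Fin n)) (τ : ℕ → Fin n) (i : ℕ) : Fin n :=
  if h : i < l.length then l[i] else τ (i - l.length)

theorem map_follow {n : ℕ} (l : List (Fin n)) (τ : ℕ → Fin n) (i : ℕ) :
    (List.range (l.length + i)).map (follow l τ) = l ++ (List.range i).map τ := by
  apply List.ext_getElem
  · simp
  · intro j h₁ h₂
    simp only [List.getElem_map, List.getElem_range, follow, List.getElem_append]

theorem correct_follow {n : ℕ} (l : List (Fin n)) {τ : ℕ → Fin n} {p : Fin n}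
    (h : Correct τ p) : Correct (follow l τ) p := by
  intro N
  obtain ⟨i, hi, rfl⟩ := h N
  exact ⟨l.length + i, by omega, by simp [follow]⟩

/-- An increasing chain of finite schedules has an infinite schedule as its limit. -/
theorem exists_limit_schedule {α : Type} (L : ℕ → List α) (hL : ∀ j, L j <+: L (j + 1))
    (hlen : ∀ j, j ≤ (L j).length) :
    ∃ σ : ℕ → α, ∀ j, (List.range (L j).length).map σ = L j := by
  have mono : ∀ i j, i ≤ j → L i <+: L j := fun i j h => by
    induction h with
    | refl => exact List.prefix_rfl
    | step _ ih => exact ih.trans (hL _)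
  refine ⟨fun i => (L (i + 1))[i]'(hlen (i + 1)), fun j => ?_⟩
  apply List.ext_getElem
  · simp
  · intro i h₁ h₂
    simp only [List.getElem_map, List.getElem_range]
    rcases le_total (i + 1) j with h | h
    · exact (mono _ _ h).getElem _
    · exact ((mono _ _ h).getElem _).symm

/-- A counter that increases by one at infinitely many times takes every large value at one of
these times. -/
theorem exists_counter_eq {T : ℕ → ℕ} {R : ℕ → Prop} (h₁ : ∀ i, R i → T (i + 1) = T i + 1)
    (h₂ : ∀ i, ¬ R i → T (i + 1) = T i) (hR : ∀ N, ∃ i, N ≤ i ∧ R i) (i K : ℕ) (hK : T i ≤ K) :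
    ∃ j, i ≤ j ∧ R j ∧ T j = K := by
  have hunb : ∀ K, ∃ a, K < T (i + a) := by
    intro K
    induction K with
    | zero =>
      obtain ⟨j, hj, hRj⟩ := hR i
      exact ⟨j - i + 1, by rw [show i + (j - i + 1) = j + 1 by omega, h₁ j hRj]; omega⟩
    | succ K ih =>
      obtain ⟨a, ha⟩ := ih
      obtain ⟨j, hj, hRj⟩ := hR (i + a)
      have hmono : Monotone T := monotone_nat_of_le_succ fun j => by
        by_cases h : R j
        · rw [h₁ j h]; omega
        · rw [h₂ j h]
      have := hmono hj
      exact ⟨j - i + 1, by rw [show i + (j - i + 1) = j + 1 by omega, h₁ j hRj]; omega⟩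
  classical
  have hspec := Nat.find_spec (hunb K)
  have hmin := fun a => Nat.find_min (hunb K) (m := a)
  generalize Nat.find (hunb K) = a at hspec hmin
  rcases a with _ | a
  · exact absurd hspec (by simpa using hK)
  have hle := hmin a (Nat.lt_succ_self a)
  have hRa : R (i + a) := by
    by_contra hno
    rw [← add_assoc, h₂ _ hno] at hspec
    exact hle hspec
  rw [← add_assoc, h₁ _ hRa] at hspec
  exact ⟨i + a, by omega, hRa, by omega⟩

/-! ### Impossibility with read/write registers -/

namespace RWAlgorithm

variable {n m : ℕ}

/-- The configuration reached from `c` by the finite schedule `l`. -/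
noncomputable def exec (A : RWAlgorithm n m) (c : A.Config) (l : List (Fin n)) : A.Config :=
  l.foldl (fun c p => A.step p c) c

variable (A : RWAlgorithm n m)

theorem exec_append (c : A.Config) (l l' : List (Fin n)) :
    A.exec c (l ++ l') = A.exec (A.exec c l) l' := List.foldl_append

theorem run_eq_exec (x : Fin n → Fin m) (σ : ℕ → Fin n) (i : ℕ) :
    A.run x σ i = A.exec (A.initial x) ((List.range i).map σ) := by
  induction i with
  | zero => rfl
  | succ i ih => rw [List.range_succ, List.map_append, exec_append, ← ih]; rfl

theorem run_follow (x : Fin n → Fin m) (l : List (Fin n)) (τ : ℕ → Fin n) (i : ℕ) :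
    A.run x (follow l τ) (l.length + i) =
      A.exec (A.exec (A.initial x) l) ((List.range i).map τ) := by
  rw [run_eq_exec, map_follow, exec_append]

theorem step_loc_of_decided {c : A.Config} {p : Fin n} {v : ℕ}
    (h : c.loc p = Status.decided v) (q : Fin n) : (A.step q c).loc p = Status.decided v := by
  unfold step
  by_cases hpq : p = q
  · subst hpq; simp [h]
  · split
    · exact h
    · split <;> simp [Function.update_of_ne hpq, h]

theorem step_loc_of_ne (c : A.Config) {p q : Fin n} (hpq : p ≠ q) :
    (A.step q c).loc p = c.loc p := by
  unfold step
  split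
  · rfl
  · split <;> simp [hpq]

theorem step_mem_of_ne {c : A.Config} {p : Fin n} {s next : A.State} {r r' : A.Reg} {v : A.Val}
    (hp : c.loc p = Status.running s) (ha : A.act p s = RWAction.write r v next) (hr : r' ≠ r) :
    (A.step p c).mem r' = c.mem r' := by
  simp [step, hp, ha, hr]

theorem exec_loc_of_decided {c : A.Config} {p : Fin n} {v : ℕ}
    (h : c.loc p = Status.decided v) (l : List (Fin n)) :
    (A.exec c l).loc p = Status.decided v := by
  induction l generalizing c with
  | nil => exact h
  | cons q l ih => exact ih (A.step_loc_of_decided h q)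

theorem run_loc_of_decided {x : Fin n → Fin m} {σ : ℕ → Fin n} {i : ℕ} {p : Fin n} {v : ℕ}
    (h : (A.run x σ i).loc p = Status.decided v) {j : ℕ} (hij : i ≤ j) :
    (A.run x σ j).loc p = Status.decided v := by
  induction hij with
  | refl => exact h
  | step _ ih => exact A.step_loc_of_decided ih _

/-- `c` and `c'` look the same to all machines except possibly `q`. -/
def SimilarExcept (q : Fin n) (c c' : A.Config) : Prop :=
  c.mem = c'.mem ∧ ∀ p, p ≠ q → c.loc p = c'.loc p

variable {A}

theorem SimilarExcept.step {q : Fin n} {c c' : A.Config} (h : A.SimilarExcept q c c')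
    {p : Fin n} (hp : p ≠ q) : A.SimilarExcept q (A.step p c) (A.step p c') := by
  have aux : ∀ s : Status A.State, ∀ p', p' ≠ q →
      Function.update c.loc p s p' = Function.update c'.loc p s p' := by
    intro s p' hp'
    by_cases hpp : p' = p
    · subst hpp; simp
    · simp [Function.update_of_ne hpp, h.2 p' hp']
  unfold RWAlgorithm.step
  rw [← h.2 p hp]
  split
  · exact h
  · split
    · exact ⟨h.1, by rw [h.1]; exact aux _⟩
    · exact ⟨by simp only [h.1], aux _⟩
    · exact ⟨h.1, aux _⟩

theorem SimilarExcept.exec {q : Fin n} {c c' : A.Config} (h : A.SimilarExcept q c c')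
    {l : List (Fin n)} (hl : q ∉ l) : A.SimilarExcept q (A.exec c l) (A.exec c' l) := by
  induction l generalizing c c' with
  | nil => exact h
  | cons p l ih =>
    simp only [List.mem_cons, not_or] at hl
    exact ih (h.step (Ne.symm hl.1)) hl.2

/-- The effect of two steps of different machines: they commute, or one of them is hidden from all
other machines, because the machine that took it has only changed its own state or because the
value it wrote has been overwritten. -/
theorem step_step_cases (A : RWAlgorithm n m) {p q : Fin n} (hpq : p ≠ q) (d : A.Config) :
    A.step q (A.step p d) = A.step p (A.step q d) ∨
    A.SimilarExcept q (A.step p d) (A.step p (A.step q d)) ∨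
    A.SimilarExcept p (A.step q (A.step p d)) (A.step p (A.step q d)) := by
  classical
  have hqp := hpq.symm
  have comm : ∀ s s' : Status A.State, Function.update (Function.update d.loc p s) q s' =
      Function.update (Function.update d.loc q s') p s :=
    fun s s' => Function.update_comm hpq s s' d.loc
  rcases hp : d.loc p with s | v
  swap
  · left
    have h1 : A.step p d = d := by simp [step, hp]
    have h2 : A.step p (A.step q d) = A.step q d := by
      have := A.step_loc_of_decided hp q
      generalize A.step q d = d' at this
      simp [step, this]
    rw [h1, h2]
  rcases hq : d.loc q with t | v
  swap
  · left
    have h1 : A.step q d = d := by simp [step, hq]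
    have h2 : A.step q (A.step p d) = A.step p d := by
      have := A.step_loc_of_decided hq p
      generalize A.step p d = d' at this
      simp [step, this]
    rw [h1, h2]
  rcases ha : A.act p s with ⟨r, f⟩ | ⟨r, v, f⟩ | v <;>
  rcases hb : A.act q t with ⟨r', g⟩ | ⟨r', v', g⟩ | v'
  all_goals try (left; simp [step, hp, hq, ha, hb, hpq, hqp, comm]; done)
  -- If `q` overwrites what `p` reads, then the read of `p` is hidden.
  · by_cases hr : r = r'
    · right; right
      refine ⟨by simp [step, hp, hq, ha, hb, hpq, hqp], ?_⟩
      intro p' hp'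
      simp [step, hp, hq, ha, hb, hpq, hqp, comm, hp']
    · left
      simp [step, hp, hq, ha, hb, hpq, hqp, comm, hr]
  -- If `q` reads what `p` overwrites, then the read of `q` is hidden.
  · by_cases hr : r = r'
    · right; left
      refine ⟨by simp [step, hp, hq, ha, hb, hpq], ?_⟩
      intro p' hp'
      simp [step, hp, hq, ha, hb, hpq, ← comm, hp']
    · left
      simp [step, hp, hq, ha, hb, hpq, hqp, comm, Ne.symm hr]
  -- If both write to the same register, then the write of `q` is hidden.
  · by_cases hr : r = r'
    · subst hr
      right; left
      refine ⟨by simp [step, hp, hq, ha, hb, hpq], ?_⟩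
      intro p' hp'
      simp [step, hp, hq, ha, hb, hpq, ← comm, hp']
    · left
      simpa [step, hp, hq, ha, hb, hpq, hqp, comm] using
        Function.update_comm hr v v' d.mem

variable (A)

/-- At least `k - 1` machines have decided on `v` in `c`. For `k > ⌈n / 2⌉` at most `n - k < k - 1`
machines deviate from the value that agreement provides, so this value must then be `v`; and
the value is reached even if one machine crashes, as at least `(n - 1) - (n - k) = k - 1` of the
others decide on it. -/
def Settled (k : ℕ) (c : A.Config) (v : ℕ) : Prop :=
  k ≤ {p | c.loc p = Status.decided v}.ncard + 1

/-- From `c`, a configuration can be reached in which `v` is settled. -/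
def Reaches (k : ℕ) (c : A.Config) (v : ℕ) : Prop :=
  ∃ l, A.Settled k (A.exec c l) v

variable {A}

theorem Settled.exec {k : ℕ} {c : A.Config} {v : ℕ} (h : A.Settled k c v) (l : List (Fin n)) :
    A.Settled k (A.exec c l) v :=
  h.trans (Nat.succ_le_succ (Set.ncard_le_ncard fun _ hp => A.exec_loc_of_decided hp l))

theorem Reaches.of_exec {k : ℕ} {c : A.Config} {v : ℕ} {l : List (Fin n)}
    (h : A.Reaches k (A.exec c l) v) : A.Reaches k c v := by
  obtain ⟨l', hl'⟩ := h
  exact ⟨l ++ l', by rwa [exec_append]⟩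

variable {val : Validity} {k : ℕ}

/-- In each execution only one value can be settled, and it is a proposed value. -/
theorem Solves.settled_unique (hA : A.Solves val k 1) (hk : n + 2 ≤ 2 * k) (hn : 2 ≤ n)
    {x : Fin n → Fin m} {l : List (Fin n)} :
    ∃ v₀, (∃ i, (x i : ℕ) = v₀) ∧
      ∀ v, A.Settled k (A.exec (A.initial x) l) v → v = v₀ := by
  obtain ⟨⟨⟨v₀, hv₀, hcard⟩, -⟩, -⟩ := hA x (follow l fun _ => ⟨0, by omega⟩)
  refine ⟨v₀, hv₀, fun v hv => ?_⟩
  by_contra hne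
  have hsub : {p | (A.exec (A.initial x) l).loc p = Status.decided v} ⊆
      {p : Fin n | ∃ w, A.Decides x (follow l fun _ => ⟨0, by omega⟩) p w ∧ w ≠ v₀} := by
    intro p hp
    refine ⟨v, ⟨l.length, ?_⟩, hne⟩
    have := A.run_follow x l (fun _ => ⟨0, by omega⟩) 0
    simp only [add_zero, List.range_zero, List.map_nil] at this
    rw [this]
    exact hp
  have := Set.ncard_le_ncard hsub
  unfold Settled at hv
  omega

/-- If only `q` may crash, then a value is settled, even when the decision of `q` is not counted. -/
theorem Solves.exists_common (hA : A.Solves val k 1)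
    (x : Fin n → Fin m) (σ : ℕ → Fin n) (q : Fin n) (hσ : ∀ p, p ≠ q → Correct σ p) :
    ∃ N v, k ≤ {p | p ≠ q ∧ (A.run x σ N).loc p = Status.decided v}.ncard + 1 := by
  obtain ⟨⟨⟨v₀, -, hcard⟩, -⟩, hterm⟩ := hA x σ
  have hcrash : AtMostCrashes 1 σ := by
    refine (Set.ncard_le_ncard (t := {q}) fun p hp => ?_).trans (Set.ncard_singleton q).le
    by_contra hne
    exact hp (hσ p hne)
  have hdec : ∀ p, ∃ i v, p ≠ q → (A.run x σ i).loc p = Status.decided v := by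
    intro p
    by_cases hp : p = q
    · exact ⟨0, 0, fun h => (h hp).elim⟩
    · obtain ⟨v, i, hi⟩ := hterm hcrash p (hσ p hp)
      exact ⟨i, v, fun _ => hi⟩
  choose i v hiv using hdec
  refine ⟨Finset.univ.sup i, v₀, ?_⟩
  have hsub : {p : Fin n | p ≠ q} ⊆
      {p | p ≠ q ∧ (A.run x σ (Finset.univ.sup i)).loc p = Status.decided v₀} ∪
        {p : Fin n | ∃ w, A.Decides x σ p w ∧ w ≠ v₀} := by
    intro p hp
    by_cases hv : v p = v₀
    · exact Or.inl ⟨hp, hv ▸ A.run_loc_of_decided (hiv p hp) (Finset.le_sup (Finset.mem_univ p))⟩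
    · exact Or.inr ⟨v p, ⟨i p, hiv p hp⟩, hv⟩
  have h1 := (Set.ncard_le_ncard hsub).trans (Set.ncard_union_le _ _)
  have h2 : {p : Fin n | p ≠ q}.ncard + 1 = n := by
    have := Set.ncard_add_ncard_compl ({q} : Set (Fin n))
    rw [Set.ncard_singleton, Nat.card_eq_fintype_card, Fintype.card_fin] at this
    change ({q}ᶜ : Set (Fin n)).ncard + 1 = n
    omega
  omega

/-- If only `q` can distinguish two configurations, then some value can be settled from both:
let `q` crash and schedule the others fairly. -/
theorem Solves.exists_reaches_of_similar (hA : A.Solves val k 1) (hn : 2 ≤ n)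
    (x : Fin n → Fin m) (l : List (Fin n)) (q : Fin n) {c : A.Config}
    (h : A.SimilarExcept q (A.exec (A.initial x) l) c) :
    ∃ v, A.Reaches k (A.exec (A.initial x) l) v ∧ A.Reaches k c v := by
  have : Nontrivial (Fin n) := Fin.nontrivial_iff_two_le.mpr hn
  obtain ⟨p₀, hp₀⟩ := exists_ne q
  have : Nonempty {p // p ≠ q} := ⟨⟨p₀, hp₀⟩⟩
  obtain ⟨f, hf⟩ := exists_fair_enumeration {p // p ≠ q}
  have hfair : ∀ p, p ≠ q → Correct (fun i => (f i : Fin n)) p := by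
    intro p hp N
    obtain ⟨i, hi, h⟩ := hf ⟨p, hp⟩ N
    exact ⟨i, hi, congrArg Subtype.val h⟩
  obtain ⟨N, v, hv⟩ := hA.exists_common x (follow l fun i => f i) q
    fun p hp => correct_follow l (hfair p hp)
  set l' := (List.range N).map fun i => (f i : Fin n) with hl'
  have hq : q ∉ l' := by
    simp only [hl', List.mem_map, not_exists, not_and]
    exact fun i _ => (f i).2
  have hrun : ∀ p, (A.run x (follow l fun i => f i) N).loc p = Status.decided v →
      (A.exec (A.exec (A.initial x) l) l').loc p = Status.decided v := by
    intro p hp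
    rw [hl', ← run_follow]
    exact A.run_loc_of_decided hp (by omega)
  have hsim := h.exec hq
  refine ⟨v, ⟨l', hv.trans (Nat.succ_le_succ (Set.ncard_le_ncard fun p hp => hrun p hp.2))⟩,
    ⟨l', hv.trans (Nat.succ_le_succ (Set.ncard_le_ncard fun p hp => ?_))⟩⟩
  exact (hsim.2 p hp.1).symm.trans (hrun p hp.2)

theorem Solves.exists_reaches (hA : A.Solves val k 1) (hn : 2 ≤ n)
    (x : Fin n → Fin m) (l : List (Fin n)) : ∃ v, A.Reaches k (A.exec (A.initial x) l) v := by
  obtain ⟨v, hv, -⟩ := hA.exists_reaches_of_similar hn x l ⟨0, by omega⟩ ⟨rfl, fun _ _ => rfl⟩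
  exact ⟨v, hv⟩

variable (A)

/-- At least two values can still be settled from `c`. -/
def Bivalent (k : ℕ) (c : A.Config) : Prop :=
  ∃ v w, v ≠ w ∧ A.Reaches k c v ∧ A.Reaches k c w

variable {A}

theorem eq_of_not_bivalent {c : A.Config} (h : ¬ A.Bivalent k c) {v w : ℕ}
    (hv : A.Reaches k c v) (hw : A.Reaches k c w) : v = w := by
  by_contra hne
  exact h ⟨v, w, hne, hv, hw⟩

/-- Change the inputs from `0` to `1` one machine after the other: if no initial configuration were
bivalent, then the value would never change along the way, but validity forces it from `0` to
`1`. -/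
theorem Solves.exists_bivalent_initial (hA : A.Solves val k 1) (hk : n + 2 ≤ 2 * k) (hn : 2 ≤ n)
    (hm : 2 ≤ m) : ∃ x, A.Bivalent k (A.initial x) := by
  by_contra! hno
  let x : ℕ → Fin n → Fin m := fun j i => if (i : ℕ) < j then ⟨1, hm⟩ else ⟨0, by omega⟩
  have hvalid : ∀ y v, A.Reaches k (A.initial y) v → ∃ i, (y i : ℕ) = v := by
    rintro y v ⟨l, hl⟩
    obtain ⟨v₀, hi, hv₀⟩ := hA.settled_unique hk hn (x := y) (l := l)
    rwa [hv₀ v hl]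
  have key : ∀ j, j ≤ n → ∀ v, A.Reaches k (A.initial (x j)) v → v = 0 := by
    intro j
    induction j with
    | zero =>
      intro _ v hv
      obtain ⟨i, rfl⟩ := hvalid _ _ hv
      simp [x]
    | succ j ih =>
      intro hj v hv
      have hsim : A.SimilarExcept ⟨j, hj⟩ (A.exec (A.initial (x j)) [])
          (A.initial (x (j + 1))) := by
        refine ⟨rfl, fun p hp => ?_⟩
        have : (p : ℕ) ≠ j := fun h => hp (Fin.ext h)
        have hiff : (p : ℕ) < j ↔ (p : ℕ) < j + 1 := by omega
        simp [exec, initial, x, hiff]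
      obtain ⟨w, hw, hw'⟩ := hA.exists_reaches_of_similar hn (x j) [] _ hsim
      rw [eq_of_not_bivalent (hno _) hv hw']
      exact ih (by omega) w hw
  obtain ⟨v, hv⟩ := hA.exists_reaches hn (x n) []
  have h0 := key n le_rfl v hv
  obtain ⟨i, hi⟩ := hvalid _ _ hv
  simp [x, h0] at hi

/-- From a bivalent configuration a bivalent one can be reached by a schedule that ends with a step
of a given machine `p`. -/
theorem Solves.exists_bivalent_extension (hA : A.Solves val k 1) (hn : 2 ≤ n)
    {x : Fin n → Fin m} {l : List (Fin n)} (hl : A.Bivalent k (A.exec (A.initial x) l))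
    (p : Fin n) : ∃ l', A.Bivalent k (A.exec (A.initial x) (l ++ l' ++ [p])) := by
  by_contra! hno
  choose F hF using fun l' => hA.exists_reaches hn x (l ++ l' ++ [p])
  have huniq : ∀ l' v, A.Reaches k (A.exec (A.initial x) (l ++ l' ++ [p])) v → v = F l' :=
    fun l' v hv => eq_of_not_bivalent (hno l') hv (hF l')
  -- `F l'` is the value fixed by scheduling `l'` and then `p`. Another step before that of `p` does
  -- not change it.
  have hstep : ∀ l' q, F (l' ++ [q]) = F l' := by
    intro l' q
    set d := A.exec (A.initial x) (l ++ l') with hd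
    have e1 : A.exec (A.initial x) (l ++ l' ++ [p]) = A.step p d := exec_append ..
    have e2 : A.exec (A.initial x) (l ++ (l' ++ [q]) ++ [p]) = A.step p (A.step q d) := by
      rw [← List.append_assoc, exec_append, exec_append, ← hd]
      rfl
    have e3 : A.exec (A.initial x) (l ++ l' ++ [p] ++ [q]) = A.step q (A.step p d) := by
      rw [exec_append, e1]
      rfl
    have of_step : ∀ v, A.Reaches k (A.step q (A.step p d)) v → v = F l' := by
      intro v hv
      apply huniq
      rw [← e3, exec_append] at hv
      exact hv.of_exec
    by_cases hpq : p = q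
    · subst hpq
      exact of_step _ (e2 ▸ hF (l' ++ [p]))
    rcases step_step_cases A hpq d with h | h | h
    · refine of_step _ ?_
      rw [h, ← e2]
      exact hF _
    · rw [← e1, ← e2] at h
      obtain ⟨v, hv, hv'⟩ := hA.exists_reaches_of_similar hn x _ q h
      rw [← huniq _ v hv, ← huniq _ v hv']
    · rw [← e3, ← e2] at h
      obtain ⟨v, hv, hv'⟩ := hA.exists_reaches_of_similar hn x _ p h
      rw [← of_step v (e3 ▸ hv), ← huniq _ v hv']
  have hconst : ∀ l', F l' = F [] := by
    intro l'
    induction l' using List.reverseRecOn with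
    | nil => rfl
    | append_singleton l' q ih => rw [hstep, ih]
  have hreach : ∀ v, A.Reaches k (A.exec (A.initial x) l) v → v = F [] := by
    rintro v ⟨l', hv⟩
    rw [← hconst l']
    refine huniq l' v ⟨[], ?_⟩
    rw [exec_append, exec_append]
    exact (hv.exec [p]).exec []
  obtain ⟨v, w, hne, hv, hw⟩ := hl
  exact hne ((hreach v hv).trans (hreach w hw).symm)

/-- Running through bivalent configurations forever while giving every machine infinitely many steps
produces an execution without crashes in which no value is ever settled. -/
theorem Solves.two_mul_lt (hA : A.Solves val k 1) (hn : 2 ≤ n) (hm : 2 ≤ m) :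
    2 * k < n + 2 := by
  by_contra! hk
  obtain ⟨x, hx⟩ := hA.exists_bivalent_initial hk hn hm
  have : Nonempty (Fin n) := ⟨⟨0, by omega⟩⟩
  obtain ⟨f, hf⟩ := exists_fair_enumeration (Fin n)
  let T := {l : List (Fin n) // A.Bivalent k (A.exec (A.initial x) l)}
  choose E hE using fun (l : T) (p : Fin n) => hA.exists_bivalent_extension hn l.2 p
  let L : ℕ → T := fun j => Nat.rec ⟨[], hx⟩ (fun j l => ⟨l.1 ++ E l (f j) ++ [f j], hE l (f j)⟩) j
  have hL : ∀ j, (L (j + 1)).1 = (L j).1 ++ E (L j) (f j) ++ [f j] := fun j => rfl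
  have hlen : ∀ j, j ≤ (L j).1.length := by
    intro j
    induction j with
    | zero => exact Nat.zero_le _
    | succ j ih =>
      rw [hL]
      simp only [List.length_append, List.length_cons, List.length_nil]
      omega
  obtain ⟨σ, hσ⟩ := exists_limit_schedule (fun j => (L j).1)
    (fun j => by rw [hL, List.append_assoc]; exact List.prefix_append _ _) hlen
  have hcorrect : ∀ p, Correct σ p := by
    intro p N
    obtain ⟨j, hj, rfl⟩ := hf p N
    have h := hσ (j + 1)
    obtain ⟨K, hK⟩ : ∃ K, (L (j + 1)).1.length = K + 1 := by
      rw [hL]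
      exact ⟨_, List.length_append⟩
    have hlast := congrArg List.getLast? h
    rw [hK, hL] at hlast
    simp [List.range_succ] at hlast
    have := hlen (j + 1)
    exact ⟨K, by omega, hlast⟩
  obtain ⟨N, v, hv⟩ := hA.exists_common x σ ⟨0, by omega⟩ fun p _ => hcorrect p
  have hsettled : A.Settled k (A.exec (A.initial x) (L N).1) v := by
    rw [← hσ N, ← run_eq_exec]
    refine hv.trans (Nat.succ_le_succ (Set.ncard_le_ncard fun p hp => ?_))
    exact A.run_loc_of_decided hp.2 (hlen N)
  obtain ⟨w₁, w₂, hne, ⟨l₁, h₁⟩, ⟨l₂, h₂⟩⟩ := (L N).2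
  have huniq : ∀ l w, A.Settled k (A.exec (A.exec (A.initial x) (L N).1) l) w → w = v := by
    intro l w hw
    have hv' := hsettled.exec l
    rw [← exec_append] at hw hv'
    obtain ⟨v₀, -, h⟩ := hA.settled_unique hk hn (x := x) (l := (L N).1 ++ l)
    rw [h w hw, h v hv']
  exact hne ((huniq _ _ h₁).trans (huniq _ _ h₂).symm)

end RWAlgorithm
/-! ### Simulating message passing with single-writer registers -/

namespace MPAlgorithm

variable {n m : ℕ}

theorem step_loc_of_decided (A : MPAlgorithm n m) {c : A.Config} {p : Fin n} {v : ℕ}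
    (h : c.loc p = Status.decided v) (i : ℕ) (q : Fin n) (o : Option ℕ) :
    (A.step i q o c).loc p = Status.decided v := by
  by_cases hpq : p = q
  · subst hpq; simp [step, h]
  · unfold step
    split
    · exact h
    · split
      · simp [hpq, h]
      · dsimp only
        split
        · simp [hpq, h]
        · split
          · simp [hpq, h]
          · split <;> simp [hpq, h]
      · simp [hpq, h]

theorem run_loc_of_decided (A : MPAlgorithm n m) {x : Fin n → Fin m} {σ : ℕ → Fin n}
    {ρ : ℕ → Option ℕ} {i : ℕ} {p : Fin n} {v : ℕ}
    (h : (A.run x σ ρ i).loc p = Status.decided v) {j : ℕ} (hij : i ≤ j) :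
    (A.run x σ ρ j).loc p = Status.decided v := by
  induction hij with
  | refl => exact h
  | step _ ih => exact A.step_loc_of_decided ih ..

/-- The local state of a machine that simulates a message passing machine in state `st`.  It has
sent `sent` messages, it has received the messages in `got` (a message is identified by its sender
and its position among the messages of this sender), and it has attempted to receive `turn`
times. -/
structure SimState (n : ℕ) (S : Type) where
  st : S
  sent : ℕ
  got : Set (Fin n × ℕ)
  turn : ℕ

open Classical in
/-- The simulating state after `p` has attempted to receive by reading register `r` and has found
the content `o`. The message is received only if it is addressed to `p` and has not been received
before, since registers are read repeatedly. -/
noncomputable def SimState.afterRead {S M : Type} (p : Fin n) (s : SimState n S)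
    (next : Option (Fin n × M) → S) (r : Fin n × ℕ) (o : Option (Fin n × M)) : SimState n S :=
  match o with
  | none => ⟨next none, s.sent, s.got, s.turn + 1⟩
  | some (dst, msg) =>
    if dst = p ∧ r ∉ s.got then ⟨next (some (r.1, msg)), s.sent, insert r s.got, s.turn + 1⟩
    else ⟨next none, s.sent, s.got, s.turn + 1⟩

theorem SimState.turn_afterRead {S M : Type} (p : Fin n) (s : SimState n S)
    (next : Option (Fin n × M) → S) (r : Fin n × ℕ) (o : Option (Fin n × M)) :
    (s.afterRead p next r o).turn = s.turn + 1 := by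
  unfold SimState.afterRead
  split
  · rfl
  · split <;> rfl

theorem SimState.mem_got_afterRead {S M : Type} (p : Fin n) (s : SimState n S)
    (next : Option (Fin n × M) → S) (r : Fin n × ℕ) (msg : M) :
    r ∈ (s.afterRead p next r (some (p, msg))).got := by
  by_cases h : r ∈ s.got <;> simp [SimState.afterRead, h]

/-- The register algorithm that simulates `A`. The message number `a` of machine `p`, together with
its destination, is written into register `(p, a)`, and the `i`-th attempt to receive reads the
register `f i`. Each step simulates one step of `A`. -/
noncomputable def toRW (A : MPAlgorithm n m) (f : ℕ → Fin n × ℕ) : RWAlgorithm n m where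
  State := SimState n A.State
  Reg := Fin n × ℕ
  Val := Option (Fin n × A.Msg)
  start p v := ⟨A.start p v, 0, ∅, 0⟩
  startVal _ := none
  act p s :=
    match A.act p s.st with
    | MPAction.send q msg next => RWAction.write (p, s.sent) (some (q, msg))
        ⟨next, s.sent + 1, s.got, s.turn⟩
    | MPAction.receive next => RWAction.read (f s.turn) (s.afterRead p next (f s.turn))
    | MPAction.decide v => RWAction.decide v

theorem singleWriter_toRW (A : MPAlgorithm n m) (f : ℕ → Fin n × ℕ) :
    (A.toRW f).SingleWriter := by
  refine ⟨Prod.fst, fun p s r v next h => ?_⟩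
  simp only [toRW] at h
  split at h
  · cases h; rfl
  · cases h
  · cases h

/-- The status of the simulated machine. -/
def simStatus {S : Type} : Status (SimState n S) → Status S
  | Status.running s => Status.running s.st
  | Status.decided v => Status.decided v

variable {A : MPAlgorithm n m}

/-- The local states `loc` and the memory `mem` of the simulation represent the configuration `d` of
`A` after `i` steps, where the message in register `r` was sent in step number `g r`. -/
structure Represents (i : ℕ) (loc : Fin n → Status (SimState n A.State))
    (mem : Fin n × ℕ → Option (Fin n × A.Msg)) (d : A.Config) (g : Fin n × ℕ → ℕ) : Prop where
  loc_eq : ∀ p, d.loc p = simStatus (loc p)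
  lt : ∀ r, mem r ≠ none → g r < i
  inj : ∀ r r', mem r ≠ none → mem r' ≠ none → g r = g r' → r = r'
  unwritten : ∀ p s, loc p = Status.running s → ∀ a, s.sent ≤ a → mem (p, a) = none
  written : ∀ p s, loc p = Status.running s → ∀ r ∈ s.got, mem r ≠ none
  net : ∀ r p msg s, mem r = some (p, msg) → loc p = Status.running s →
    (r ∉ s.got ∧ d.net (g r) = some ⟨r.1, p, msg⟩) ∨ (r ∈ s.got ∧ d.net (g r) = none)
  sent : ∀ j e, d.net j = some e → ∃ r, mem r = some (e.dst, e.msg) ∧ g r = j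

namespace Represents

variable {i : ℕ} {loc : Fin n → Status (SimState n A.State)}
  {mem : Fin n × ℕ → Option (Fin n × A.Msg)} {d : A.Config} {g : Fin n × ℕ → ℕ} {p : Fin n}
  {s : SimState n A.State}

theorem congr (h : Represents i loc mem d g) {g' : Fin n × ℕ → ℕ}
    (hg : ∀ r, mem r ≠ none → g' r = g r) : Represents i loc mem d g' where
  loc_eq := h.loc_eq
  lt r hr := by rw [hg r hr]; exact h.lt r hr
  inj r r' hr hr' := by rw [hg r hr, hg r' hr']; exact h.inj r r' hr hr'
  unwritten := h.unwritten
  written := h.written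
  net r p msg s hr := by rw [hg r (by simp [hr])]; exact h.net r p msg s hr
  sent j e he := by
    obtain ⟨r, hr, hj⟩ := h.sent j e he
    exact ⟨r, hr, by rw [hg r (by simp [hr]), hj]⟩

theorem loc_eq_running (h : Represents i loc mem d g) (hp : loc p = Status.running s) :
    d.loc p = Status.running s.st := by
  rw [h.loc_eq, hp]; rfl

theorem succ (h : Represents i loc mem d g) : Represents (i + 1) loc mem d g where
  __ := h
  lt r hr := (h.lt r hr).trans (Nat.lt_succ_self i)

/-- A step of `p` that changes nothing but the simulated state. -/
theorem update_running (h : Represents i loc mem d g) (hp : loc p = Status.running s)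
    (st : A.State) (turn : ℕ) :
    Represents i (Function.update loc p (Status.running ⟨st, s.sent, s.got, turn⟩)) mem
      ⟨Function.update d.loc p (Status.running st), d.net⟩ g where
  loc_eq q := by
    by_cases hq : q = p
    · subst hq; simp [simStatus]
    · simp [hq, h.loc_eq]
  lt := h.lt
  inj := h.inj
  unwritten q s' hs' := by
    by_cases hq : q = p
    · subst hq
      obtain rfl : _ = s' := by simpa using hs'
      exact h.unwritten q s hp
    · exact h.unwritten q s' (by simpa [hq] using hs')
  written q s' hs' := by
    by_cases hq : q = p
    · subst hq
      obtain rfl : _ = s' := by simpa using hs'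
      exact h.written q s hp
    · exact h.written q s' (by simpa [hq] using hs')
  net r q msg s' hr hs' := by
    by_cases hq : q = p
    · subst hq
      obtain rfl : _ = s' := by simpa using hs'
      exact h.net r q msg s hr hp
    · exact h.net r q msg s' hr (by simpa [hq] using hs')
  sent := h.sent

theorem update_decided (h : Represents i loc mem d g) (p : Fin n) (v : ℕ) :
    Represents i (Function.update loc p (Status.decided v)) mem
      ⟨Function.update d.loc p (Status.decided v), d.net⟩ g where
  loc_eq q := by
    by_cases hq : q = p
    · subst hq; simp [simStatus]
    · simp [hq, h.loc_eq]
  lt := h.lt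
  inj := h.inj
  unwritten q s' hs' := by
    by_cases hq : q = p
    · simp [hq] at hs'
    · exact h.unwritten q s' (by simpa [hq] using hs')
  written q s' hs' := by
    by_cases hq : q = p
    · simp [hq] at hs'
    · exact h.written q s' (by simpa [hq] using hs')
  net r q msg s' hr hs' := by
    by_cases hq : q = p
    · simp [hq] at hs'
    · exact h.net r q msg s' hr (by simpa [hq] using hs')
  sent := h.sent

/-- The decidability instance is a variable, to match the one in `RWAlgorithm.step`. -/
theorem send [dec : DecidableEq (Fin n × ℕ)] (h : Represents i loc mem d g)
    (hp : loc p = Status.running s) (hg : g (p, s.sent) = i) (st : A.State)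
    (q : Fin n) (msg : A.Msg) :
    Represents (i + 1)
      (Function.update loc p (Status.running ⟨st, s.sent + 1, s.got, s.turn⟩))
      (Function.update mem (p, s.sent) (some (q, msg)))
      ⟨Function.update d.loc p (Status.running st),
        Function.update d.net i (some ⟨p, q, msg⟩)⟩ g := by
  have hfree : mem (p, s.sent) = none := h.unwritten p s hp _ le_rfl
  -- The machines other than `p` keep their states, and `p` keeps the set of received messages.
  have hold : ∀ q' s', Function.update loc p
      (Status.running ⟨st, s.sent + 1, s.got, s.turn⟩) q' = Status.running s' →
      ∃ s₀, loc q' = Status.running s₀ ∧ s₀.got = s'.got ∧ s₀.sent ≤ s'.sent ∧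
        (q' = p → s.sent < s'.sent) := by
    intro q' s' hs'
    by_cases hq : q' = p
    · subst hq
      obtain rfl : _ = s' := by simpa using hs'
      exact ⟨s, hp, rfl, Nat.le_succ _, fun _ => Nat.lt_succ_self _⟩
    · exact ⟨s', by simpa [hq] using hs', rfl, le_rfl, fun h => (hq h).elim⟩
  have hlt : ∀ r, r ≠ (p, s.sent) →
      Function.update mem (p, s.sent) (some (q, msg)) r ≠ none → g r < i := by
    intro r hr h'
    exact h.lt r (by simpa [hr] using h')
  constructor
  · intro q'
    by_cases hq : q' = p
    · subst hq; simp [simStatus]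
    · simp [hq, h.loc_eq]
  · intro r hr
    by_cases hr' : r = (p, s.sent)
    · rw [hr', hg]; omega
    · exact (hlt r hr' hr).trans (Nat.lt_succ_self i)
  · intro r r' hr hr' hrr
    by_cases e : r = (p, s.sent) <;> by_cases e' : r' = (p, s.sent)
    · rw [e, e']
    · have := hlt r' e' hr'
      rw [← hrr, e, hg] at this
      omega
    · have := hlt r e hr
      rw [hrr, e', hg] at this
      omega
    · exact h.inj r r' (by simpa [e] using hr) (by simpa [e'] using hr') hrr
  · intro q' s' hs' a ha
    obtain ⟨s₀, h₀, -, hle, hlt'⟩ := hold q' s' hs'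
    have hne : (q', a) ≠ (p, s.sent) := by
      intro e
      simp only [Prod.mk.injEq] at e
      have := hlt' e.1
      omega
    rw [Function.update_of_ne hne]
    exact h.unwritten q' s₀ h₀ a (hle.trans ha)
  · intro q' s' hs' r hr
    obtain ⟨s₀, h₀, hgot, -, -⟩ := hold q' s' hs'
    by_cases e : r = (p, s.sent)
    · simp [e]
    · simpa [e] using h.written q' s₀ h₀ r (hgot ▸ hr)
  · intro r q' msg' s' hr hs'
    obtain ⟨s₀, h₀, hgot, -, -⟩ := hold q' s' hs'
    rw [← hgot]
    by_cases e : r = (p, s.sent)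
    · subst e
      obtain ⟨rfl, rfl⟩ : q = q' ∧ msg = msg' := by simpa using hr
      left
      exact ⟨fun hmem => h.written q s₀ h₀ _ hmem hfree, by simp [hg]⟩
    · have hr' : mem r = some (q', msg') := by simpa [e] using hr
      have := h.lt r (by simp [hr'])
      simp only [Function.update_of_ne this.ne]
      exact h.net r q' msg' s₀ hr' h₀
  · intro j e he
    by_cases hj : j = i
    · subst hj
      obtain rfl : _ = e := by simpa using he
      exact ⟨(p, s.sent), by simp, hg⟩
    · obtain ⟨r, hr, hrj⟩ := h.sent j e (by simpa [hj] using he)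
      have hne : r ≠ (p, s.sent) := by
        rintro rfl
        simp [hfree] at hr
      exact ⟨r, by simpa [hne] using hr, hrj⟩

theorem receive (h : Represents i loc mem d g) (hp : loc p = Status.running s)
    {r : Fin n × ℕ} (hr : r ∉ s.got) {msg : A.Msg} (hmem : mem r = some (p, msg)) (st : A.State)
    (turn : ℕ) :
    Represents i (Function.update loc p (Status.running ⟨st, s.sent, insert r s.got, turn⟩)) mem
      ⟨Function.update d.loc p (Status.running st), Function.update d.net (g r) none⟩ g where
  loc_eq q := by
    by_cases hq : q = p
    · subst hq; simp [simStatus]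
    · simp [hq, h.loc_eq]
  lt := h.lt
  inj := h.inj
  unwritten q s' hs' := by
    by_cases hq : q = p
    · subst hq
      obtain rfl : _ = s' := by simpa using hs'
      exact h.unwritten q s hp
    · exact h.unwritten q s' (by simpa [hq] using hs')
  written q s' hs' := by
    by_cases hq : q = p
    · subst hq
      obtain rfl : _ = s' := by simpa using hs'
      rintro r' (rfl | hr')
      · simp [hmem]
      · exact h.written q s hp r' hr'
    · exact h.written q s' (by simpa [hq] using hs')
  net r' q msg' s' hr' hs' := by
    have hg : r' ≠ r → g r' ≠ g r := fun hne e =>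
      hne (h.inj r' r (by simp [hr']) (by simp [hmem]) e)
    by_cases hq : q = p
    · subst hq
      obtain rfl : _ = s' := by simpa using hs'
      by_cases hrr : r' = r
      · subst hrr; simp
      · simpa [hrr, hg hrr] using h.net r' q msg' s hr' hp
    · have hrr : r' ≠ r := by
        rintro rfl
        rw [hmem] at hr'
        simp only [Option.some.injEq, Prod.mk.injEq] at hr'
        exact hq hr'.1.symm
      simpa [hg hrr] using h.net r' q msg' s' hr' (by simpa [hq] using hs')
  sent j e he := by
    by_cases hj : j = g r
    · simp [hj] at he
    · exact h.sent j e (by simpa [hj] using he)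

end Represents

open Classical in
/-- The behaviour of the network by which a step of `p` in `A` matches the step of the
simulation. -/
noncomputable def simChoice {S M : Type} (f : ℕ → Fin n × ℕ) (ls : Status (SimState n S))
    (mem : Fin n × ℕ → Option (Fin n × M)) (g : Fin n × ℕ → ℕ) : Option ℕ :=
  match ls with
  | Status.decided _ => none
  | Status.running s => if mem (f s.turn) = none then none else some (g (f s.turn))

/-- One step of `p` in the simulation matches one step of `p` in `A`. The index `g r` of a register
that is still unwritten is set to `i`, the number of this step, in case this step writes it. -/
theorem Represents.step {f : ℕ → Fin n × ℕ} {i : ℕ} {c : (A.toRW f).Config} {d : A.Config}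
    {g : Fin n × ℕ → ℕ} (h : Represents i c.loc c.mem d g) (hg : ∀ r, c.mem r = none → g r = i)
    (p : Fin n) :
    Represents (i + 1) ((A.toRW f).step p c).loc ((A.toRW f).step p c).mem
      (A.step i p (simChoice f (c.loc p) c.mem g) d) g := by
  obtain ⟨loc, mem⟩ := c
  change Represents i loc mem d g at h
  change ∀ r, mem r = none → g r = i at hg
  dsimp only
  rcases hp : loc p with s | v
  swap
  · have h1 : (A.toRW f).step p ⟨loc, mem⟩ = ⟨loc, mem⟩ := by simp [RWAlgorithm.step, hp]
    have h2 : ∀ o, A.step i p o d = d := by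
      simp [MPAlgorithm.step, h.loc_eq, hp, simStatus]
    rw [h1, h2]
    exact h.succ
  have hd := h.loc_eq_running hp
  rcases ha : A.act p s.st with ⟨q, msg, next⟩ | next | v
  · have hb : (A.toRW f).act p s = RWAction.write (p, s.sent) (some (q, msg))
        ⟨next, s.sent + 1, s.got, s.turn⟩ := by simp [toRW, ha]
    simp only [RWAlgorithm.step, hp, hb, MPAlgorithm.step, hd, ha]
    exact Represents.send (dec := fun _ _ => Classical.propDecidable _) h hp
      (hg _ (h.unwritten p s hp _ le_rfl)) ..
  · have hb : (A.toRW f).act p s =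
        RWAction.read (f s.turn) (s.afterRead p next (f s.turn)) := by simp [toRW, ha]
    simp only [RWAlgorithm.step, hp, hb, MPAlgorithm.step, hd, ha, simChoice]
    rcases hr : mem (f s.turn) with _ | ⟨q, msg⟩
    · simp only [if_true, SimState.afterRead]
      exact (h.update_running hp ..).succ
    · simp only [SimState.afterRead, reduceCtorEq, if_false]
      by_cases hq : q = p
      · subst hq
        rcases h.net _ _ _ _ hr hp with ⟨hgot, hnet⟩ | ⟨hgot, hnet⟩
        · simp only [hgot, not_false_eq_true, and_self, if_true, hnet]
          exact (h.receive hp hgot hr ..).succ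
        · simp only [hgot, not_true_eq_false, and_false, if_false, hnet]
          exact (h.update_running hp ..).succ
      · simp only [hq, false_and, if_false]
        rcases he : d.net (g (f s.turn)) with _ | e
        · exact (h.update_running hp ..).succ
        · obtain ⟨r', hr', hg'⟩ := h.sent _ e he
          obtain rfl := h.inj r' _ (by simp [hr']) (by simp [hr]) hg'
          -- The message handed over is not addressed to `p`, so `A` receives nothing either.
          have : e.dst ≠ p := by
            rw [hr] at hr'
            simp only [Option.some.injEq, Prod.mk.injEq] at hr'
            rwa [← hr'.1]
          simp only [this, if_false]
          exact (h.update_running hp ..).succ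
  · have hb : (A.toRW f).act p s = RWAction.decide v := by simp [toRW, ha]
    simp only [RWAlgorithm.step, hp, hb, MPAlgorithm.step, hd, ha]
    exact (h.update_decided p v).succ

theorem Represents.step_mem {f : ℕ → Fin n × ℕ} {i : ℕ} {c : (A.toRW f).Config} {d : A.Config}
    {g : Fin n × ℕ → ℕ} (h : Represents i c.loc c.mem d g) (p : Fin n) {r : Fin n × ℕ}
    (hr : c.mem r ≠ none) : ((A.toRW f).step p c).mem r = c.mem r := by
  obtain ⟨loc, mem⟩ := c
  change Represents i loc mem d g at h
  change mem r ≠ none at hr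
  rcases hp : loc p with s | v
  swap
  · simp [RWAlgorithm.step, hp]
  rcases ha : A.act p s.st with ⟨q, msg, next⟩ | next | v
  · have hb : (A.toRW f).act p s = RWAction.write (p, s.sent) (some (q, msg))
        ⟨next, s.sent + 1, s.got, s.turn⟩ := by simp [toRW, ha]
    have hne : r ≠ (p, s.sent) := by
      rintro rfl
      exact hr (h.unwritten p s hp _ le_rfl)
    exact RWAlgorithm.step_mem_of_ne _ hp hb hne
  · have hb : (A.toRW f).act p s =
        RWAction.read (f s.turn) (s.afterRead p next (f s.turn)) := by simp [toRW, ha]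
    simp only [RWAlgorithm.step, hp, hb]
  · have hb : (A.toRW f).act p s = RWAction.decide v := by simp [toRW, ha]
    simp only [RWAlgorithm.step, hp, hb]

variable (A) (f : ℕ → Fin n × ℕ) (x : Fin n → Fin m) (σ : ℕ → Fin n)

open Classical in
/-- The number of the step that wrote the message into a register, for the registers written in the
first `i` steps of the simulation. -/
noncomputable def simIndex : ℕ → Fin n × ℕ → ℕ
  | 0, _ => 0
  | i + 1, r => if ((A.toRW f).run x σ i).mem r = none then i else simIndex i r

/-- The network behaviour in the execution of `A` that is simulated. -/
noncomputable def simNetwork (i : ℕ) : Option ℕ :=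
  simChoice f (((A.toRW f).run x σ i).loc (σ i)) ((A.toRW f).run x σ i).mem
    (simIndex A f x σ (i + 1))

/-- The execution of the simulation represents the execution of `A` with the network behaviour
`simNetwork`. -/
theorem represents_run (i : ℕ) :
    Represents i ((A.toRW f).run x σ i).loc ((A.toRW f).run x σ i).mem
      (A.run x σ (simNetwork A f x σ) i) (simIndex A f x σ i) := by
  induction i with
  | zero =>
    constructor
    · intro p; rfl
    · intro r hr; exact (hr rfl).elim
    · intro r r' hr; exact (hr rfl).elim
    · intros; rfl
    · intro p s hs r hr
      have : (⟨A.start p (x p), 0, ∅, 0⟩ : SimState n A.State) = s := by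
        simpa [RWAlgorithm.run, RWAlgorithm.initial, toRW] using hs
      simp [← this] at hr
    · intro r p msg s hr
      cases hr
    · intro j e he
      cases he
  | succ i ih =>
    refine (ih.congr (g' := simIndex A f x σ (i + 1)) fun r hr => ?_).step (fun r hr => ?_) (σ i)
    · exact if_neg hr
    · exact if_pos hr

theorem run_mem_simIndex_of_le {r : Fin n × ℕ} {i j : ℕ} (hij : i ≤ j)
    (hr : ((A.toRW f).run x σ i).mem r ≠ none) :
    ((A.toRW f).run x σ j).mem r = ((A.toRW f).run x σ i).mem r ∧
      simIndex A f x σ j r = simIndex A f x σ i r := by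
  induction hij with
  | refl => exact ⟨rfl, rfl⟩
  | @step j _ ih =>
    have hr' : ((A.toRW f).run x σ j).mem r ≠ none := by rwa [ih.1]
    refine ⟨((represents_run A f x σ j).step_mem (σ j) hr').trans ih.1, ?_⟩
    exact (if_neg hr').trans ih.2

theorem decides_toRW_iff (p : Fin n) (v : ℕ) :
    (A.toRW f).Decides x σ p v ↔ A.Decides x σ (simNetwork A f x σ) p v := by
  refine exists_congr fun i => ?_
  rw [(represents_run A f x σ i).loc_eq p]
  cases ((A.toRW f).run x σ i).loc p <;> simp [simStatus]

/-- The simulated network is reliable if every register is read again and again: a message that has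
been written into a register is received at the latest when this register is read next. -/
theorem reliable_simNetwork (hf : ∀ r N, ∃ i, N ≤ i ∧ f i = r) :
    A.Reliable x σ (simNetwork A f x σ) := by
  intro p hinf i j e he hep
  have hrep := represents_run A f x σ
  obtain ⟨r, hr, hj⟩ := (hrep i).sent j e he
  rw [hep] at hr
  have hrunning : ∀ k, ∃ s : SimState n A.State,
      ((A.toRW f).run x σ k).loc p = Status.running s := by
    intro k
    obtain ⟨k', hk', -, s, next, hs, -⟩ := hinf k
    rcases hk : ((A.toRW f).run x σ k).loc p with s | v
    · exact ⟨s, rfl⟩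
    · rw [(hrep k').loc_eq p, RWAlgorithm.run_loc_of_decided _ hk hk'] at hs
      cases hs
  choose s hs using hrunning
  have hst : ∀ k, (A.run x σ (simNetwork A f x σ) k).loc p = Status.running (s k).st :=
    fun k => (hrep k).loc_eq_running (hs k)
  have hreceive : ∀ k, A.ReceivesAt x σ (simNetwork A f x σ) p k →
      ∃ next, s (k + 1) = (s k).afterRead p next (f (s k).turn)
        (((A.toRW f).run x σ k).mem (f (s k).turn)) := by
    rintro k ⟨hσ, t, next, ht, ha⟩
    rw [hst k] at ht
    obtain rfl : (s k).st = t := by simpa using ht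
    have hb : (A.toRW f).act p (s k) =
        RWAction.read (f (s k).turn) ((s k).afterRead p next (f (s k).turn)) := by simp [toRW, ha]
    have := hs (k + 1)
    simp only [RWAlgorithm.run, hσ, RWAlgorithm.step, hs k, hb, Function.update_self] at this
    exact ⟨next, (Status.running.inj this).symm⟩
  have hother : ∀ k, ¬ A.ReceivesAt x σ (simNetwork A f x σ) p k →
      (s (k + 1)).turn = (s k).turn := by
    intro k hk
    have := hs (k + 1)
    by_cases hσ : σ k = p
    swap
    · rw [RWAlgorithm.run, RWAlgorithm.step_loc_of_ne _ _ (Ne.symm hσ), hs k] at this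
      rw [Status.running.inj this]
    rcases ha : A.act p (s k).st with ⟨q, msg, next⟩ | next | v
    · have hb : (A.toRW f).act p (s k) = RWAction.write (p, (s k).sent) (some (q, msg))
          ⟨next, (s k).sent + 1, (s k).got, (s k).turn⟩ := by simp [toRW, ha]
      simp only [RWAlgorithm.run, hσ, RWAlgorithm.step, hs k, hb, Function.update_self] at this
      rw [← Status.running.inj this]
    · exact (hk ⟨hσ, _, next, hst k, ha⟩).elim
    · have hb : (A.toRW f).act p (s k) = RWAction.decide v := by simp [toRW, ha]
      simp [RWAlgorithm.run, hσ, RWAlgorithm.step, hs k, hb] at this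
  have hturn : ∀ k, A.ReceivesAt x σ (simNetwork A f x σ) p k →
      (s (k + 1)).turn = (s k).turn + 1 := by
    intro k hk
    obtain ⟨next, h⟩ := hreceive k hk
    exact (congrArg SimState.turn h).trans (SimState.turn_afterRead ..)
  obtain ⟨K, hK, hfK⟩ := hf r (s i).turn
  obtain ⟨k, hik, hRk, hTk⟩ := exists_counter_eq (T := fun k => (s k).turn) hturn hother hinf i K hK
  have hmem : ((A.toRW f).run x σ i).mem r ≠ none := by rw [hr]; exact Option.some_ne_none _
  have hmem' := (run_mem_simIndex_of_le A f x σ hik hmem).1.trans hr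
  obtain ⟨hmem₁, hidx⟩ := run_mem_simIndex_of_le A f x σ (hik.trans (Nat.le_succ k)) hmem
  obtain ⟨next, hnext⟩ := hreceive k hRk
  have hgot : r ∈ (s (k + 1)).got := by
    rw [hnext, hTk, hfK, hmem']
    exact SimState.mem_got_afterRead ..
  refine ⟨k + 1, hik.trans (Nat.le_succ k), ?_⟩
  rcases (hrep (k + 1)).net r p e.msg _ (hmem₁.trans hr) (hs (k + 1)) with h | h
  · exact (h.1 hgot).elim
  · rw [← hj, ← hidx]
    exact h.2

end MPAlgorithm

/-- Message passing can be simulated with single-writer registers. -/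
theorem SolvableMP.solvableSWMR {val : Validity} {n m k t : ℕ} (hn : 0 < n)
    (h : SolvableMP val n m k t) : SolvableSWMR val n m k t := by
  obtain ⟨A, hA⟩ := h
  have : Nonempty (Fin n × ℕ) := ⟨⟨0, hn⟩, 0⟩
  obtain ⟨f, hf⟩ := exists_fair_enumeration (Fin n × ℕ)
  refine ⟨A.toRW f, A.singleWriter_toRW f, fun x σ => ?_⟩
  have hdec : (A.toRW f).Decides x σ = A.Decides x σ (A.simNetwork f x σ) := by
    ext p v
    exact A.decides_toRW_iff f x σ p v
  rw [hdec]
  obtain ⟨hsafe, hterm⟩ := hA x σ (A.simNetwork f x σ)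
  exact ⟨hsafe, fun hσ => hterm hσ (A.reliable_simNetwork f x σ hf)⟩

/-! ### An algorithm with two leaders -/

/-- If at most two values are decided, both of them proposed, then the more popular one is decided
by all but at most half of the machines. -/
theorem safe_of_two_values {n m k : ℕ} (hk : 2 * k ≤ n + 1) (val : Validity)
    {x : Fin n → Fin m} {D : Fin n → ℕ → Prop} (hD : ∀ p v w, D p v → D p w → v = w)
    {a b : Fin n} (hab : ∀ p w, D p w → w = x a ∨ w = x b) : Safe val k x D := by
  refine ⟨?_, fun _ p w hw => (hab p w hw).elim (fun h => ⟨a, h.symm⟩) fun h => ⟨b, h.symm⟩⟩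
  have hdisj : Disjoint {p | ∃ w, D p w ∧ w ≠ (x a : ℕ)} {p | ∃ w, D p w ∧ w ≠ (x b : ℕ)} := by
    rw [Set.disjoint_left]
    rintro p ⟨w, hw, hwa⟩ ⟨w', hw', hwb⟩
    rw [← hD p w w' hw hw'] at hwb
    exact (hab p w hw).elim hwa hwb
  have hcard := Set.ncard_le_ncard (Set.subset_univ
    ({p | ∃ w, D p w ∧ w ≠ (x a : ℕ)} ∪ {p | ∃ w, D p w ∧ w ≠ (x b : ℕ)}))
  rw [Set.ncard_union_eq hdisj, Set.ncard_univ, Nat.card_eq_fintype_card, Fintype.card_fin] at hcard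
  rcases le_total {p | ∃ w, D p w ∧ w ≠ (x a : ℕ)}.ncard {p | ∃ w, D p w ∧ w ≠ (x b : ℕ)}.ncard
    with h | h
  · exact ⟨x a, ⟨a, rfl⟩, by omega⟩
  · exact ⟨x b, ⟨b, rfl⟩, by omega⟩

namespace MPAlgorithm

variable {n m : ℕ}

theorem step_loc_of_ne (A : MPAlgorithm n m) (c : A.Config) {p q : Fin n} (hpq : p ≠ q) (i : ℕ)
    (o : Option ℕ) : (A.step i q o c).loc p = c.loc p := by
  unfold step
  split
  · rfl
  · split
    · simp [hpq]
    · dsimp only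
      split
      · simp [hpq]
      · split
        · simp [hpq]
        · split <;> simp [hpq]
    · simp [hpq]

/-- A message stays in transit until it is received by its destination. -/
theorem step_net (A : MPAlgorithm n m) {c : A.Config} {i j : ℕ} {e : Envelope n A.Msg}
    (he : c.net j = some e) (hj : j ≠ i) (q : Fin n) (o : Option ℕ) :
    (A.step i q o c).net j = some e ∨
      ∃ s next, c.loc q = Status.running s ∧ A.act q s = MPAction.receive next ∧ e.dst = q ∧
        (A.step i q o c).loc q = Status.running (next (some (e.src, e.msg))) := by
  rcases hq : c.loc q with s | v
  swap
  · left; simp [step, hq, he]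
  rcases ha : A.act q s with ⟨r, msg, next⟩ | next | v
  · left; simp [step, hq, ha, hj, he]
  swap
  · left; simp [step, hq, ha, he]
  rcases o with _ | j'
  · left; simp [step, hq, ha, he]
  rcases he' : c.net j' with _ | e'
  · left; simp [step, hq, ha, he, he']
  by_cases hdst : e'.dst = q
  swap
  · left; simp [step, hq, ha, he, he', hdst]
  by_cases hjj : j = j'
  · subst hjj
    obtain rfl : e = e' := by simpa [he] using he'
    right
    exact ⟨s, next, rfl, ha, hdst, by simp [step, hq, ha, he, hdst]⟩
  · left; simp [step, hq, ha, he, he', hdst, hjj]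

/-- A machine that does not crash takes a step from its current state. -/
theorem exists_next_step (A : MPAlgorithm n m) (x : Fin n → Fin m) {σ : ℕ → Fin n}
    (ρ : ℕ → Option ℕ) {p : Fin n} (hp : Correct σ p) (i : ℕ) :
    ∃ i', i ≤ i' ∧ σ i' = p ∧ (A.run x σ ρ i').loc p = (A.run x σ ρ i).loc p := by
  classical
  have hex : ∃ a, σ (i + a) = p := by
    obtain ⟨j, hj, h⟩ := hp i
    exact ⟨j - i, by rwa [Nat.add_sub_cancel' hj]⟩
  have hmin : ∀ a, a ≤ Nat.find hex → (A.run x σ ρ (i + a)).loc p = (A.run x σ ρ i).loc p := by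
    intro a
    induction a with
    | zero => exact fun _ => rfl
    | succ a ih =>
      intro ha
      rw [← ih (by omega)]
      exact A.step_loc_of_ne _ (Ne.symm (Nat.find_min hex ha)) ..
  exact ⟨i + Nat.find hex, by omega, Nat.find_spec hex, hmin _ le_rfl⟩

/-- The machines `0` and `1` are leaders: they send their inputs to everybody and decide on them.
All others wait for a message and decide on its content. The state `none` is that of a waiting
machine; in the state `some (v, j)`, a machine has to send `v` to the machines `j, …, n - 1` before
deciding on `v`. -/
def twoLeaders (n m : ℕ) : MPAlgorithm n m where
  State := Option (ℕ × ℕ)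
  Msg := ℕ
  start p v := if (p : ℕ) < 2 then some (v, 0) else none
  act _ s :=
    match s with
    | none => MPAction.receive fun o => o.map fun e => (e.2, n)
    | some (v, j) =>
      if h : j < n then MPAction.send ⟨j, h⟩ v (some (v, j + 1)) else MPAction.decide v

section twoLeaders

variable {x : Fin n → Fin m} {σ : ℕ → Fin n} {ρ : ℕ → Option ℕ}

/-- The value carried by a status of `twoLeaders n m`, if there is one, is in `V`. -/
def StatusIn (V : Set ℕ) : Status (Option (ℕ × ℕ)) → Prop
  | Status.running none => True
  | Status.running (some (v, _)) => v ∈ V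
  | Status.decided v => v ∈ V

/-- All values that occur in the configuration `c` are in `V`. -/
structure ValuesIn (V : Set ℕ) (c : (twoLeaders n m).Config) : Prop where
  loc : ∀ p, StatusIn V (c.loc p)
  net : ∀ i q r (v : ℕ), c.net i = some ⟨q, r, v⟩ → v ∈ V

theorem ValuesIn.update {V : Set ℕ} {c : (twoLeaders n m).Config} (h : ValuesIn V c) (p : Fin n)
    {s : Status (Option (ℕ × ℕ))} (hs : StatusIn V s)
    {net : ℕ → Option (Envelope n (twoLeaders n m).Msg)}
    (hnet : ∀ i q r (v : ℕ), net i = some ⟨q, r, v⟩ → v ∈ V) :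
    ValuesIn V ⟨Function.update c.loc p s, net⟩ where
  loc q := by
    by_cases hq : q = p
    · subst hq
      exact (congrArg (StatusIn V) (Function.update_self q s c.loc)).mpr hs
    · exact (congrArg (StatusIn V) (Function.update_of_ne hq s c.loc)).mpr (h.loc q)
  net := hnet

theorem ValuesIn.step {V : Set ℕ} {c : (twoLeaders n m).Config} (h : ValuesIn V c) (i : ℕ)
    (p : Fin n) (o : Option ℕ) : ValuesIn V ((twoLeaders n m).step i p o c) := by
  have hloc := h.loc p
  unfold MPAlgorithm.step
  split
  · exact h
  next s hs =>
  rw [hs] at hloc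
  rcases s with _ | ⟨v, j⟩
  · have hnothing := h.update p (s := Status.running none) trivial h.net
    dsimp only [twoLeaders]
    split
    · exact hnothing
    · split
      · exact hnothing
      next e he =>
      split
      · refine h.update p (s := Status.running (some (e.msg, n))) (h.net _ _ _ _ he) ?_
        intro i' q r v hv
        rw [Function.update_apply] at hv
        split at hv
        · cases hv
        · exact h.net _ _ _ _ hv
      · exact hnothing
  · by_cases hj : j < n
    · have ha : (twoLeaders n m).act p (some (v, j)) =
        MPAction.send ⟨j, hj⟩ v (some (v, j + 1)) := dif_pos hj
      simp only [ha]
      refine h.update p (s := Status.running (some (v, j + 1))) hloc ?_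
      intro i' q r w hw
      by_cases hi : i' = i
      · subst hi
        rw [Function.update_self] at hw
        cases hw
        exact hloc
      · rw [Function.update_of_ne hi] at hw
        exact h.net _ _ _ _ hw
    · have ha : (twoLeaders n m).act p (some (v, j)) = MPAction.decide v := dif_neg hj
      simp only [ha]
      exact h.update p (s := Status.decided v) hloc h.net

theorem valuesIn_run (hn : 2 ≤ n) (i : ℕ) :
    ValuesIn {v | v = (x ⟨0, by omega⟩ : ℕ) ∨ v = (x ⟨1, hn⟩ : ℕ)}
      ((twoLeaders n m).run x σ ρ i) := by
  induction i with
  | zero =>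
    refine ⟨fun p => ?_, fun i q r v h => by cases h⟩
    obtain ⟨p, hp⟩ := p
    match p with
    | 0 => exact Or.inl rfl
    | 1 => exact Or.inr rfl
    | p + 2 => trivial
  | succ i ih => exact ih.step ..

theorem exists_run_eq_some {p : Fin n} (hp : Correct σ p) {i v j : ℕ}
    (hi : ((twoLeaders n m).run x σ ρ i).loc p = Status.running (some (v, j))) {j' : ℕ}
    (hj : j ≤ j') (hj' : j' ≤ n) :
    ∃ i', i ≤ i' ∧ σ i' = p ∧
      ((twoLeaders n m).run x σ ρ i').loc p = Status.running (some (v, j')) := by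
  induction hj with
  | refl =>
    obtain ⟨i', h₁, h₂, h₃⟩ := exists_next_step _ x ρ hp i
    exact ⟨i', h₁, h₂, h₃.trans hi⟩
  | @step j' _ ih =>
    obtain ⟨i₁, h₁, h₂, h₃⟩ := ih (by omega)
    have h₄ : ((twoLeaders n m).run x σ ρ (i₁ + 1)).loc p = Status.running (some (v, j' + 1)) := by
      have ha : (twoLeaders n m).act p (some (v, j')) =
        MPAction.send ⟨j', hj'⟩ v (some (v, j' + 1)) := dif_pos hj'
      simp only [run, step, h₂, h₃, ha]
      exact Function.update_self ..
    obtain ⟨i₂, h₅, h₆, h₇⟩ := exists_next_step _ x ρ hp (i₁ + 1)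
    exact ⟨i₂, by omega, h₆, h₇.trans h₄⟩

theorem exists_decides_of_run_eq_some {p : Fin n} (hp : Correct σ p) {i v j : ℕ}
    (hi : ((twoLeaders n m).run x σ ρ i).loc p = Status.running (some (v, j))) :
    ∃ v, (twoLeaders n m).Decides x σ ρ p v := by
  obtain ⟨i', j', hj', h₂, h₃⟩ : ∃ i' j', n ≤ j' ∧ σ i' = p ∧
      ((twoLeaders n m).run x σ ρ i').loc p = Status.running (some (v, j')) := by
    rcases le_total j n with hj | hj
    · obtain ⟨i', -, h⟩ := exists_run_eq_some hp hi hj le_rfl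
      exact ⟨i', n, le_rfl, h⟩
    · obtain ⟨i', -, h₂, h₃⟩ := exists_next_step _ x ρ hp i
      exact ⟨i', j, hj, h₂, h₃.trans hi⟩
  have ha : (twoLeaders n m).act p (some (v, j')) = MPAction.decide v := dif_neg hj'.not_gt
  exact ⟨v, i' + 1, by simp [run, step, h₂, h₃, ha]⟩

/-- Safety holds because only the inputs of the two leaders are decided. At most one leader crashes,
and the message of the other one reaches everybody. -/
theorem solves_twoLeaders (hn : 2 ≤ n) {k : ℕ} (hk : 2 * k ≤ n + 1) (val : Validity) :
    (twoLeaders n m).Solves val k 1 := by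
  intro x σ ρ
  constructor
  · refine safe_of_two_values hk val ?_ (a := ⟨0, by omega⟩) (b := ⟨1, hn⟩) ?_
    · rintro p v w ⟨i, hi⟩ ⟨j, hj⟩
      have hi' := run_loc_of_decided _ hi (le_max_left i j)
      rw [run_loc_of_decided _ hj (le_max_right i j)] at hi'
      exact (Status.decided.inj hi').symm
    · rintro p w ⟨i, hi⟩
      have h := (valuesIn_run (x := x) (σ := σ) (ρ := ρ) hn i).loc p
      rw [hi] at h
      exact h
  intro hσ hρ p hp
  by_contra hno
  have hwait : ∀ i, ((twoLeaders n m).run x σ ρ i).loc p = Status.running none := by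
    intro i
    rcases hi : ((twoLeaders n m).run x σ ρ i).loc p with s | v
    · rcases s with _ | ⟨v, j⟩
      · rfl
      · exact (hno (exists_decides_of_run_eq_some hp hi)).elim
    · exact (hno ⟨v, i, hi⟩).elim
  have hinf : ∀ N, ∃ i, N ≤ i ∧ (twoLeaders n m).ReceivesAt x σ ρ p i := by
    intro N
    obtain ⟨i, hi, hσi⟩ := hp N
    exact ⟨i, hi, hσi, none, _, hwait i, rfl⟩
  -- One of the leaders does not crash.
  obtain ⟨q, hq, hq2⟩ : ∃ q : Fin n, Correct σ q ∧ (q : ℕ) < 2 := by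
    by_contra! h
    have h0 : ¬ Correct σ ⟨0, by omega⟩ := fun hc => absurd (h _ hc) (by simp)
    have h1 : ¬ Correct σ ⟨1, hn⟩ := fun hc => absurd (h _ hc) (by simp)
    have := (Set.ncard_le_one (Set.toFinite _)).mp hσ _ h0 _ h1
    simp at this
  have hstart : ((twoLeaders n m).run x σ ρ 0).loc q = Status.running (some ((x q : ℕ), 0)) := by
    exact congrArg Status.running (if_pos hq2)
  obtain ⟨i, -, hσi, hi⟩ := exists_run_eq_some hq hstart (Nat.zero_le p) p.2.le
  have ha : (twoLeaders n m).act q (some ((x q : ℕ), (p : ℕ))) =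
    MPAction.send p (x q : ℕ) (some ((x q : ℕ), (p : ℕ) + 1)) := dif_pos p.2
  have hsent : ((twoLeaders n m).run x σ ρ (i + 1)).net i = some ⟨q, p, (x q : ℕ)⟩ := by
    simp [run, step, hσi, hi, ha]
  have hstay : ∀ l, i + 1 ≤ l →
      ((twoLeaders n m).run x σ ρ l).net i = some ⟨q, p, (x q : ℕ)⟩ := by
    intro l hl
    induction hl with
    | refl => exact hsent
    | @step l hl ih =>
      refine (step_net _ ih (ne_of_lt hl) (σ l) (ρ l)).resolve_right ?_
      -- If `p` received the message, it would no longer be waiting.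
      rintro ⟨s, next, hs, hact, hdst, hloc⟩
      obtain rfl : p = σ l := hdst
      rw [hwait l] at hs
      cases hs
      cases hact
      cases (hwait (l + 1)).symm.trans hloc
  obtain ⟨i', hi', hnone⟩ := hρ p hinf (i + 1) i _ hsent rfl
  cases hnone.symm.trans (hstay i' hi')

end twoLeaders

end MPAlgorithm

theorem solvableMP_of_two_mul_le {n m k : ℕ} (hn : 2 ≤ n) (hk : 2 * k ≤ n + 1) (val : Validity) :
    SolvableMP val n m k 1 :=
  ⟨MPAlgorithm.twoLeaders n m, MPAlgorithm.solves_twoLeaders hn hk val⟩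

theorem le_ceil_half_iff (n k : ℕ) : k ≤ ⌈(n : ℚ) / 2⌉₊ ↔ 2 * k ≤ n + 1 := by
  rcases k with _ | k
  · simp
  · rw [Nat.succ_le_iff, Nat.lt_ceil, lt_div_iff₀ two_pos]
    norm_cast
    omega

end PartialAgreement

theorem corollary2 (n m k : ℕ) (hn : 2 ≤ n) (hm : 2 ≤ m) (val : PartialAgreement.Validity) :
    (PartialAgreement.SolvableMWMR val n m k 1 ↔ k ≤ ⌈(n : ℚ) / 2⌉₊) ∧
    (PartialAgreement.SolvableSWMR val n m k 1 ↔ k ≤ ⌈(n : ℚ) / 2⌉₊) ∧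
    (PartialAgreement.SolvableMP val n m k 1 ↔ k ≤ ⌈(n : ℚ) / 2⌉₊) := by
  rw [PartialAgreement.le_ceil_half_iff]
  have h₁ : 2 * k ≤ n + 1 → PartialAgreement.SolvableMP val n m k 1 := fun hk =>
    PartialAgreement.solvableMP_of_two_mul_le hn hk val
  have h₂ : PartialAgreement.SolvableMP val n m k 1 → PartialAgreement.SolvableSWMR val n m k 1 :=
    PartialAgreement.SolvableMP.solvableSWMR (by omega)
  have h₃ : PartialAgreement.SolvableSWMR val n m k 1 → PartialAgreement.SolvableMWMR val n m k 1 :=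
    fun ⟨A, _, hA⟩ => ⟨A, hA⟩
  have h₄ : PartialAgreement.SolvableMWMR val n m k 1 → 2 * k ≤ n + 1 := fun ⟨_, hA⟩ =>
    Nat.lt_succ_iff.mp (hA.two_mul_lt hn hm)
  tauto
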